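/- Write $\mathbb R/\mathbb Z$ for the circle and $|\cdot|$ for the distance to $0$ in $\mathbb R/\mathbb Z$. Let $f\colon\mathbb R/\mathbb Z\to\mathbb R/\mathbb Z$ be an orientation-preserving circle diffeomorphism of class $C^2$, put $D_f:=\int_{\mathbb R/\mathbb Z}\left|\frac{f''(x)}{f'(x)}\right|\,dx$ and, for $\omega\in\mathbb R/\mathbb Z$, $f_\omega:=f+\omega$. Let $\operatorname{rot}(g)\in\mathbb R/\mathbb Z$ denote the rotation number of an orientation-preserving circle homeomorphism $g$, that is, the class modulo $1$ of $\lim_{n\to\infty}\frac1n\bigl(G^{\circ n}(x)-x\bigr)$ for any lift $G\colon\mathbb R\to\mathbb R$ of $g$ and any $x\in\mathbb R$. (1) Suppose that $\theta:=\operatorname{rot}(f)$ is irrational, and let $p/q$ be a convergent of the continued fraction expansion of (a real representative of) $\theta$. Then there is an $\omega\in\mathbb R/\mathbb Z$ with $$\operatorname{rot}(f_\omega)=p/q\quad\text{and}\quad|\omega|\le e^{D_f}\cdot|\theta-p/q|,$$ and if $f$ is not a rotation $x\mapsto x+a$, then $\omega$ can moreover be chosen so that the inequality is strict: $|\omega|<e^{D_f}\cdot|\theta-p/q|$.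 (2) (Tsujii's theorem) Call $\alpha\in\mathbb R/\mathbb Z$ Diophantine if there are constants $c>0$ and $\beta>0$ such that $|\alpha-p/q|>c/q^{2+\beta}$ for all rational numbers $p/q$ (in lowest terms, $q\geq 1$), and Liouville if it is irrational but not Diophantine. Whether or not $\operatorname{rot}(f)$ is irrational, the set of $\omega\in\mathbb R/\mathbb Z$ such that $\operatorname{rot}(f_\omega)$ is Liouville has Lebesgue measure zero. -/

import Mathlib

open MeasureTheory

namespace CircleDynamics

noncomputable section

/-- `F : ℝ → ℝ` is a (continuous) lift of the circle map `f : ℝ/ℤ → ℝ/ℤ`. -/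
structure IsLift (F : ℝ → ℝ) (f : UnitAddCircle → UnitAddCircle) : Prop where
  continuous : Continuous F
  coe_apply : ∀ x : ℝ, ((F x : ℝ) : UnitAddCircle) = f (x : UnitAddCircle)

/-- A circle map is `C²` if it has a lift to the universal cover `ℝ` which is `C²`. -/
def IsC2Map (f : UnitAddCircle → UnitAddCircle) : Prop :=
  ∃ F : ℝ → ℝ, IsLift F f ∧ ContDiff ℝ 2 F

/-- Orientation preserving `C²` diffeomorphisms of the circle `ℝ/ℤ`: bijections which are `C²`
together with their inverse, and which have an increasing lift. -/
structure IsC2Diffeo (f : UnitAddCircle ≃ UnitAddCircle) : Prop where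
  isC2Map : IsC2Map f
  isC2Map_symm : IsC2Map f.symm
  orientation : ∃ F : ℝ → ℝ, IsLift F f ∧ StrictMono F

/-- Two lifts of the same circle map differ by an integer. -/
theorem IsLift.exists_int {F G : ℝ → ℝ} {f : UnitAddCircle → UnitAddCircle}
    (hF : IsLift F f) (hG : IsLift G f) : ∃ m : ℤ, ∀ x, F x = G x + m := by
  have h : ∀ x, ∃ m : ℤ, (m : ℝ) = F x - G x := by
    intro x
    have h0 : ((F x - G x : ℝ) : UnitAddCircle) = 0 := by
      rw [AddCircle.coe_sub, hF.coe_apply, hG.coe_apply, sub_self]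
    obtain ⟨m, hm⟩ := (AddCircle.coe_eq_zero_iff (1 : ℝ)).1 h0
    exact ⟨m, by simpa using hm⟩
  choose m hm using h
  have hc : Continuous (fun x => (m x : ℝ)) := by
    simp only [hm]
    exact hF.continuous.sub hG.continuous
  have hc' : Continuous m := Int.isClosedEmbedding_coe_real.isEmbedding.continuous_iff.2 hc
  refine ⟨m 0, fun x => ?_⟩
  have : m x = m 0 := PreconnectedSpace.constant inferInstance hc'
  rw [← this, hm]
  ring

/-- The lifts of orientation preserving homeomorphisms of the circle are monotone maps of degree
one, so that Mathlib's theory of the translation number applies to them. -/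
theorem IsC2Diffeo.exists_isLift {f : UnitAddCircle ≃ UnitAddCircle} (hf : IsC2Diffeo f) :
    ∃ F : CircleDeg1Lift, IsLift F f := by
  obtain ⟨F, hF, hmono⟩ := hf.orientation
  have hF1 : IsLift (fun x => F (x + 1)) f :=
    ⟨hF.continuous.comp (continuous_id.add continuous_const), fun x => by
      rw [hF.coe_apply, AddCircle.coe_add_period]⟩
  obtain ⟨m, hm⟩ := hF1.exists_int hF
  have hm0 : F 1 = F 0 + m := by simpa using hm 0
  have hpos : (0 : ℝ) < m := by
    have := hmono (zero_lt_one (α := ℝ))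
    linarith
  have hpos' : 0 < m := by exact_mod_cast hpos
  have hm1 : m = 1 := by
    by_contra hne
    have h2 : (2 : ℤ) ≤ m := by omega
    have h2' : (2 : ℝ) ≤ m := by exact_mod_cast h2
    obtain ⟨y, hy, hy'⟩ : F 0 + 1 ∈ F '' Set.Ioo 0 1 :=
      intermediate_value_Ioo zero_le_one hF.continuous.continuousOn
        ⟨by linarith, by linarith⟩
    have h3 : f (y : UnitAddCircle) = f ((0 : ℝ) : UnitAddCircle) := by
      rw [← hF.coe_apply, ← hF.coe_apply, hy', AddCircle.coe_add_period]
    have h4 := f.injective h3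
    rw [AddCircle.coe_zero] at h4
    obtain ⟨k, hk⟩ := (AddCircle.coe_eq_zero_iff (1 : ℝ)).1 h4
    have hk' : (k : ℝ) = y := by simpa using hk
    rw [← hk'] at hy
    have a1 : (0 : ℤ) < k := by exact_mod_cast hy.1
    have a2 : k < (1 : ℤ) := by exact_mod_cast hy.2
    omega
  refine ⟨⟨⟨F, hmono.monotone⟩, fun x => ?_⟩, ⟨hF.continuous, hF.coe_apply⟩⟩
  have := hm x
  rw [hm1] at this
  simpa using this

open Classical in
/-- A chosen degree one monotone lift of `f` (the identity if there is none). Lifts are unique up to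
an additive integer constant. -/
def lift (f : UnitAddCircle → UnitAddCircle) : CircleDeg1Lift :=
  if h : ∃ F : CircleDeg1Lift, IsLift F f then h.choose else 1

theorem isLift_lift {f : UnitAddCircle → UnitAddCircle} (h : ∃ F : CircleDeg1Lift, IsLift F f) :
    IsLift (lift f) f := by
  rw [lift, dif_pos h]
  exact h.choose_spec

/-- The rotation number `rot f ∈ ℝ/ℤ`: the class modulo `1` of the translation number
`lim (Fⁿ(x) - x)/n` of a lift `F` of `f`. -/
def rot (f : UnitAddCircle → UnitAddCircle) : UnitAddCircle :=
  ((lift f).translationNumber : UnitAddCircle)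

/-- `D_f = ∫_{ℝ/ℤ} |f''/f'|`, where the derivatives of `f` are those of a lift. -/
def distortionConst (f : UnitAddCircle → UnitAddCircle) : ℝ :=
  ∫ x in (0 : ℝ)..1, |deriv (deriv (lift f)) x / deriv (lift f) x|

/-- The rotation number does not depend on the lift. -/
theorem rot_eq {F : CircleDeg1Lift} {f : UnitAddCircle → UnitAddCircle} (hF : IsLift F f) :
    rot f = (F.translationNumber : UnitAddCircle) := by
  obtain ⟨m, hm⟩ := (isLift_lift ⟨F, hF⟩).exists_int hF
  have h1 : lift f = (CircleDeg1Lift.translate (Multiplicative.ofAdd (m : ℝ)) : CircleDeg1Lift) * F := by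
    ext x
    rw [hm, CircleDeg1Lift.mul_apply, CircleDeg1Lift.translate_apply, add_comm]
  have hcomm : Commute (CircleDeg1Lift.translate (Multiplicative.ofAdd (m : ℝ)) : CircleDeg1Lift)
      F := by
    rw [CircleDeg1Lift.commute_iff_commute]
    intro x
    simp
  rw [rot, h1, CircleDeg1Lift.translationNumber_mul_of_commute hcomm,
    CircleDeg1Lift.translationNumber_translate, AddCircle.coe_add]
  have : ((m : ℝ) : UnitAddCircle) = 0 :=
    (AddCircle.coe_eq_zero_iff (1 : ℝ)).2 ⟨m, by simp⟩
  rw [this, zero_add]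

/-- `D_f` does not depend on the lift. -/
theorem distortionConst_eq {F : CircleDeg1Lift} {f : UnitAddCircle → UnitAddCircle}
    (hF : IsLift F f) :
    distortionConst f = ∫ x in (0 : ℝ)..1, |deriv (deriv F) x / deriv F x| := by
  obtain ⟨m, hm⟩ := (isLift_lift ⟨F, hF⟩).exists_int hF
  have h1 : deriv (lift f) = deriv F := by
    funext x
    rw [show (lift f : ℝ → ℝ) = fun x => F x + (m : ℝ) from funext hm, deriv_add_const]
  rw [distortionConst, h1]

/-- The family `f_ω = f + ω`, `ω ∈ ℝ/ℤ`. -/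
def shift (f : UnitAddCircle → UnitAddCircle) (ω : UnitAddCircle) :
    UnitAddCircle → UnitAddCircle :=
  fun x => f x + ω

/-- `f` is a rigid rotation `x ↦ x + a`. -/
def IsRotation (f : UnitAddCircle → UnitAddCircle) : Prop :=
  ∃ a : UnitAddCircle, ∀ x, f x = x + a

/-- `θ ∈ ℝ/ℤ` is irrational: it is not the class of a rational number. -/
def IsIrrational (θ : UnitAddCircle) : Prop :=
  ∀ r : ℚ, θ ≠ ((r : ℝ) : UnitAddCircle)

/-- `θ ∈ ℝ/ℤ` is Diophantine: there are `c, β > 0` with `|θ - p/q| > c / q^(2+β)` for all rational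
numbers `p/q` in lowest terms. Here `‖·‖` is the distance to `0` in `ℝ/ℤ`. -/
def IsDiophantine (θ : UnitAddCircle) : Prop :=
  ∃ c > (0 : ℝ), ∃ β > (0 : ℝ), ∀ r : ℚ,
    c / (r.den : ℝ) ^ (2 + β) < ‖θ - ((r : ℝ) : UnitAddCircle)‖

/-- `θ ∈ ℝ/ℤ` is Liouville: irrational but not Diophantine. -/
def IsLiouville (θ : UnitAddCircle) : Prop :=
  IsIrrational θ ∧ ¬ IsDiophantine θ

end

end CircleDynamics

/-! Take p/q < θ; the other case follows by conjugating with x ↦ -x. Let t ≥ 0 be the largest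
parameter for which G = F - t satisfies G^q(x) ≥ x + p for all x. By maximality, G has translation
number p/q, so it remains to bound t.

A monotone semiconjugacy of F to the translation by θ places the arcs [G^i x, F^i x], i < q, over
intervals of length at most qθ - p. Since p/q is a best approximation, these arcs are disjoint on
the circle, and the total variation of log F' over them is at most D. Denjoy's argument
(`exp_neg_distortion_mul_iterDeriv_le`) then compares derivatives of iterates of G with those of F
at a cost of e^{-D}. Telescoping F^q - G^q into q terms gives, with DF^m the derivative of F^m, t (1
+ e^{-D} ∑ DF^{q-1-k}(F^{k+1} x)) ≤ F^q x - x - p, where 0 ≤ k < q - 1. Average this along an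
F-orbit of length N. The right side tends to qθ - p. On the left, the averages of DF^m are at least
1 - O(1/N), because y ≥ 1 + log y and the base point is chosen so that the logarithms of F' sum to
0. Hence t (1 + e^{-D}(q - 1)) ≤ qθ - p (`mul_le_of_le_iterate_addConst`), which implies t ≤ e^D (θ
- p/q), strictly when D > 0. If D = 0, then F is a translation.

For Tsujii's theorem, apply the bound at every parameter with Liouville rotation number. Such a
parameter lies within e^D c/q^3 of an endpoint of the set of parameters with rotation number k/q,
for some k/q. Each q contributes at most 2q balls, so the total measure is O(c ∑ 1/q^2), and c is
arbitrarily small. -/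

namespace CircleDynamics

/-! ### Best rational approximations -/

/-- `p / q` is a best approximation of the second kind of `θ`. -/
structure IsBestApprox (θ : ℝ) (p : ℤ) (q : ℕ) : Prop where
  pos : 0 < q
  lt_one : |(q : ℝ) * θ - p| < 1
  lt : ∀ m : ℕ, 0 < m → m < q → ∀ r : ℤ, |(q : ℝ) * θ - p| < |(m : ℝ) * θ - r|

theorem IsBestApprox.neg {θ : ℝ} {p : ℤ} {q : ℕ} (h : IsBestApprox θ p q) :
    IsBestApprox (-θ) (-p) q := by
  have key : ∀ (m : ℕ) (r : ℤ), |(m : ℝ) * -θ - ((-r : ℤ) : ℝ)| = |(m : ℝ) * θ - r| := by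
    intro m r
    rw [← abs_neg]
    congr 1
    push_cast
    ring
  refine ⟨h.pos, by rw [key]; exact h.lt_one, fun m hm hmq r => ?_⟩
  have := h.lt m hm hmq (-r)
  rwa [key, ← neg_neg r, key]

/-- The vectors (q, p) and (q', p') form a basis of ℤ², so (m, r) = a(q, p) + b(q', p'). As 0 < m <
q ≤ q', the coefficients a and b are nonzero of opposite signs. The two errors also have opposite
signs, so their contributions to mθ - r add up without cancellation. -/
theorem isBestApprox_of_adjacent {θ : ℝ} {p p' : ℤ} {q q' : ℤ} (hq : 0 < q) (hqq' : q ≤ q')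
    (hdet : p * q' - p' * q = 1 ∨ p * q' - p' * q = -1)
    (hsign : ((q : ℝ) * θ - p) * ((q' : ℝ) * θ - p') < 0) {m : ℤ} (hm : 0 < m) (hmq : m < q)
    (r : ℤ) : |(q : ℝ) * θ - p| < |(m : ℝ) * θ - r| := by
  obtain ⟨a, b, ha, hb⟩ : ∃ a b : ℤ, m = a * q + b * q' ∧ r = a * p + b * p' := by
    rcases hdet with h | h
    · exact ⟨r * q' - m * p', m * p - r * q, by linear_combination (-m) * h,
        by linear_combination (-r) * h⟩
    · exact ⟨-(r * q' - m * p'), -(m * p - r * q), by linear_combination m * h,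
        by linear_combination r * h⟩
  have hb0 : b ≠ 0 := by
    rintro rfl
    have : 0 < a := by nlinarith
    nlinarith
  have ha0 : a ≠ 0 := by
    rintro rfl
    have : 0 < b := by nlinarith
    nlinarith
  have hab : a * b < 0 := by
    rcases lt_or_gt_of_ne ha0 with h1 | h1 <;> rcases lt_or_gt_of_ne hb0 with h2 | h2 <;>
      nlinarith
  have e : (m : ℝ) * θ - r = a * ((q : ℝ) * θ - p) + b * ((q' : ℝ) * θ - p') := by
    rw [ha, hb]; push_cast; ring
  set u := (q : ℝ) * θ - p
  set v := (q' : ℝ) * θ - p'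
  have hab' : (a : ℝ) * b < 0 := by exact_mod_cast hab
  have hpos : 0 < (a * u) * (b * v) := by nlinarith [mul_pos_of_neg_of_neg hab' hsign]
  have hv : v ≠ 0 := by rintro h; simp [h] at hsign
  have h1 : |a * u + b * v| = |a * u| + |b * v| := by
    rw [abs_add_eq_add_abs_iff]
    rcases (mul_pos_iff.1 hpos) with h | h
    · exact Or.inl ⟨h.1.le, h.2.le⟩
    · exact Or.inr ⟨h.1.le, h.2.le⟩
  have h2 : 0 < |b * v| := abs_pos.2 (mul_ne_zero (by exact_mod_cast hb0) hv)
  have h3 : (1 : ℝ) ≤ |(a : ℝ)| := by exact_mod_cast Int.one_le_abs ha0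
  rw [e, h1, abs_mul (a : ℝ) u]
  nlinarith [abs_nonneg u]

/-- If p/q = [a₀; …, aₙ], the companion is p'/q' = [a₀; …, aₙ + 1], on the other side of ξ. The
clause for 1 < ξ feeds the induction: inverting the fractional part turns numerators into
denominators. -/
theorem exists_adjacent_convergent (n : ℕ) : ∀ {ξ : ℝ}, Irrational ξ →
    ∃ p q p' q' : ℤ, 0 < q ∧ q ≤ q' ∧ (1 < ξ → 0 < p ∧ p ≤ p') ∧
      (p * q' - p' * q = 1 ∨ p * q' - p' * q = -1) ∧
      ((q : ℝ) * ξ - p) * ((q' : ℝ) * ξ - p') < 0 ∧ ξ.convergent n = (p : ℚ) / q := by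
  induction n with
  | zero =>
    intro ξ hξ
    refine ⟨⌊ξ⌋, 1, ⌊ξ⌋ + 1, 1, one_pos, le_rfl, fun h => ⟨Int.floor_pos.2 h.le, by omega⟩,
      Or.inr (by ring), ?_, by simp⟩
    have h1 : (⌊ξ⌋ : ℝ) < ξ := lt_of_le_of_ne (Int.floor_le ξ) (hξ.ne_int _).symm
    have h2 := Int.lt_floor_add_one ξ
    push_cast
    nlinarith
  | succ n ih =>
    intro ξ hξ
    have hf0 : 0 < Int.fract ξ := Int.fract_pos.2 (hξ.ne_int _)
    have hη : Irrational (Int.fract ξ)⁻¹ := by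
      rw [irrational_inv_iff]
      exact hξ.sub_intCast _
    have hη1 : 1 < (Int.fract ξ)⁻¹ := (one_lt_inv₀ hf0).2 (Int.fract_lt_one ξ)
    obtain ⟨p, q, p', q', hq, hqq, hp, hdet, hs, hc⟩ := ih hη
    obtain ⟨hp0, hpp⟩ := hp hη1
    refine ⟨⌊ξ⌋ * p + q, p, ⌊ξ⌋ * p' + q', p', hp0, hpp, fun h => ?_, ?_, ?_, ?_⟩
    · have := Int.floor_pos.2 h.le
      constructor <;> nlinarith
    · rcases hdet with h | h
      · exact Or.inr (by linear_combination -h)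
      · exact Or.inl (by linear_combination -h)
    · have e : ξ = ⌊ξ⌋ + Int.fract ξ := (Int.floor_add_fract ξ).symm
      set φ := Int.fract ξ
      have e1 : ∀ a b : ℤ, (a : ℝ) * ξ - ((⌊ξ⌋ * a + b : ℤ) : ℝ) = -φ * (b * φ⁻¹ - a) := by
        intro a b
        push_cast
        nth_rewrite 1 [e]
        field_simp
        ring
      rw [e1, e1]
      nlinarith [mul_pos hf0 hf0]
    · rw [Real.convergent_succ, hc]
      have : (p : ℚ) ≠ 0 := by exact_mod_cast hp0.ne'
      push_cast
      field_simp

theorem isBestApprox_convergent {θ : ℝ} (hθ : Irrational θ) (n : ℕ) :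
    IsBestApprox θ (θ.convergent n).num (θ.convergent n).den ∧
      |((θ.convergent n).den : ℝ) * θ - (θ.convergent n).num| < 1 / (θ.convergent n).den := by
  obtain ⟨p, q, p', q', hq, hqq, -, hdet, hs, hc⟩ := exists_adjacent_convergent n hθ
  have hcop : IsCoprime p q := by
    rcases hdet with h | h
    · exact ⟨q', -p', by linear_combination h⟩
    · exact ⟨-q', p', by linear_combination -h⟩
  have hcop' : Nat.Coprime p.natAbs q.natAbs := Int.isCoprime_iff_gcd_eq_one.1 hcop
  have hnum : (θ.convergent n).num = p := by rw [hc]; exact Rat.num_div_eq_of_coprime hq hcop'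
  have hden : ((θ.convergent n).den : ℤ) = q := by
    rw [hc]; exact Rat.den_div_eq_of_coprime hq hcop'
  have hdenR : ((θ.convergent n).den : ℝ) = q := by exact_mod_cast hden
  have hqR : (1 : ℝ) ≤ q := by exact_mod_cast hq
  have hqqR : (q : ℝ) ≤ q' := by exact_mod_cast hqq
  have hbound : |(q : ℝ) * θ - p| < 1 / q := by
    rw [lt_div_iff₀ (by linarith)]
    have hd : ((q : ℝ) * θ - p) * q' - (q' * θ - p') * q = 1 ∨
        ((q : ℝ) * θ - p) * q' - (q' * θ - p') * q = -1 := by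
      rcases hdet with h | h
      · right
        have : (p : ℝ) * q' - p' * q = 1 := by exact_mod_cast h
        linear_combination -this
      · left
        have : (p : ℝ) * q' - p' * q = -1 := by exact_mod_cast h
        linear_combination -this
    rcases mul_neg_iff.1 hs with h | h
    · rw [abs_of_pos h.1]
      rcases hd with h' | h' <;> nlinarith
    · rw [abs_of_neg h.1]
      rcases hd with h' | h' <;> nlinarith
  rw [hnum, hdenR]
  refine ⟨⟨(θ.convergent n).den_pos, ?_, fun m hm hmq r => ?_⟩, hbound⟩
  · rw [hdenR]
    refine hbound.trans_le ?_
    rw [div_le_one (by linarith)]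
    exact hqR
  · rw [hdenR]
    have := isBestApprox_of_adjacent (θ := θ) hq hqq hdet hs (m := m) (by exact_mod_cast hm)
      (by rw [← hden]; exact_mod_cast hmq) r
    simpa using this

/-- The nonzero integer mp - rq equals q(mθ - r) - m(qθ - p). If |mθ - r| ≤ |qθ - p|, its absolute
value would be at most (q + m)|qθ - p| < 1. -/
theorem isBestApprox_of_abs_lt {θ : ℝ} {p : ℤ} {q : ℕ} (hq : 0 < q)
    (hpq : IsCoprime p (q : ℤ)) (h : |(q : ℝ) * θ - p| < 1 / (2 * q)) : IsBestApprox θ p q := by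
  have hq1 : (1 : ℝ) ≤ q := by exact_mod_cast hq
  have hlt : |(q : ℝ) * θ - p| * (2 * q) < 1 := (lt_div_iff₀ (by positivity)).1 h
  refine ⟨hq, by nlinarith [abs_nonneg ((q : ℝ) * θ - p)], fun m hm hmq r => ?_⟩
  have hne : (m : ℤ) * p - r * q ≠ 0 := by
    intro h0
    have : (q : ℤ) ∣ m * p := ⟨r, by linear_combination h0⟩
    have := hpq.symm.dvd_of_dvd_mul_right this
    have := Int.le_of_dvd (by exact_mod_cast hm) this
    omega
  have h1 : (1 : ℝ) ≤ |(m : ℝ) * p - r * q| := by exact_mod_cast Int.one_le_abs hne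
  have hmR : (m : ℝ) < q := by exact_mod_cast hmq
  have hm0 : (0 : ℝ) < m := by exact_mod_cast hm
  have e : (m : ℝ) * p - r * q = q * (m * θ - r) - m * (q * θ - p) := by ring
  have h2 := abs_sub (q * ((m : ℝ) * θ - r)) (m * (q * θ - p))
  rw [← e, abs_mul, abs_mul, abs_of_pos hm0, abs_of_pos (by linarith : (0 : ℝ) < q)] at h2
  by_contra! hcon
  nlinarith [abs_nonneg ((q : ℝ) * θ - p)]

/-! ### Lifts, derivatives of iterates, and semiconjugacy to a translation -/

/-- The lift `x ↦ F x + t`. -/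
def addConst (F : CircleDeg1Lift) (t : ℝ) : CircleDeg1Lift where
  toFun x := F x + t
  monotone' _ _ h := add_le_add_left (F.monotone h) t
  map_add_one' x := by rw [F.map_add_one]; ring

@[simp] theorem addConst_apply (F : CircleDeg1Lift) (t x : ℝ) : addConst F t x = F x + t := rfl

/-- Lifts of orientation preserving `C²` diffeomorphisms. -/
structure IsC2Lift (F : CircleDeg1Lift) : Prop where
  contDiff : ContDiff ℝ 2 F
  deriv_pos : ∀ x, 0 < deriv F x

/-- The total variation of `log F'` over a period. -/
noncomputable def distortion (F : CircleDeg1Lift) : ℝ :=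
  ∫ x in (0 : ℝ)..1, |deriv (deriv F) x / deriv F x|

theorem deriv_addConst (F : CircleDeg1Lift) (t : ℝ) : deriv (addConst F t) = deriv F := by
  funext x
  rw [show (addConst F t : ℝ → ℝ) = fun x => F x + t from rfl, deriv_add_const]

theorem distortion_addConst (F : CircleDeg1Lift) (t : ℝ) :
    distortion (addConst F t) = distortion F := by
  rw [distortion, distortion, deriv_addConst]

/-- The derivative of the `m`-th iterate of `F`, as a product. -/
noncomputable def iterDeriv (F : CircleDeg1Lift) (m : ℕ) (x : ℝ) : ℝ :=
  ∏ i ∈ Finset.range m, deriv F (F^[i] x)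

namespace IsC2Lift

variable {F : CircleDeg1Lift}

theorem addConst (hF : IsC2Lift F) (t : ℝ) : IsC2Lift (addConst F t) :=
  ⟨hF.contDiff.add contDiff_const, fun x => by rw [deriv_addConst]; exact hF.deriv_pos x⟩

theorem hasDerivAt (hF : IsC2Lift F) (x : ℝ) : HasDerivAt F (deriv F x) x :=
  (hF.contDiff.differentiable (by norm_num) x).hasDerivAt

theorem continuous (hF : IsC2Lift F) : Continuous F := hF.contDiff.continuous

theorem strictMono (hF : IsC2Lift F) : StrictMono F := strictMono_of_deriv_pos hF.deriv_pos

theorem bijective (hF : IsC2Lift F) : Function.Bijective F :=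
  ⟨hF.strictMono.injective, F.continuous_iff_surjective.1 hF.continuous⟩

theorem contDiff_deriv (hF : IsC2Lift F) : ContDiff ℝ 1 (deriv F) :=
  (contDiff_succ_iff_deriv (n := 1).1 hF.contDiff).2.2

theorem continuous_deriv (hF : IsC2Lift F) : Continuous (deriv F) := hF.contDiff_deriv.continuous

theorem continuous_deriv_deriv (hF : IsC2Lift F) : Continuous (deriv (deriv F)) :=
  hF.contDiff_deriv.continuous_deriv (by norm_num)

theorem continuous_deriv_div (hF : IsC2Lift F) :
    Continuous fun x => deriv (deriv F) x / deriv F x :=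
  hF.continuous_deriv_deriv.div hF.continuous_deriv fun x => (hF.deriv_pos x).ne'

end IsC2Lift

theorem periodic_deriv (F : CircleDeg1Lift) : Function.Periodic (deriv F) 1 := by
  intro x
  rw [← deriv_comp_add_const, show (fun y => F (y + 1)) = fun y => F y + 1 from
    funext F.map_add_one, deriv_add_const]

theorem periodic_deriv_deriv (F : CircleDeg1Lift) : Function.Periodic (deriv (deriv F)) 1 := by
  intro x
  rw [← deriv_comp_add_const, show (fun y => deriv F (y + 1)) = deriv F from
    funext (periodic_deriv F)]

theorem distortion_nonneg (F : CircleDeg1Lift) : 0 ≤ distortion F :=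
  intervalIntegral.integral_nonneg zero_le_one fun _ _ => abs_nonneg _

namespace IsC2Lift

variable {F : CircleDeg1Lift}

theorem abs_log_deriv_sub_le (hF : IsC2Lift F) {x y : ℝ} (hxy : x ≤ y) :
    |Real.log (deriv F y) - Real.log (deriv F x)| ≤
      ∫ z in x..y, |deriv (deriv F) z / deriv F z| := by
  have h : ∫ z in x..y, deriv (deriv F) z / deriv F z =
      Real.log (deriv F y) - Real.log (deriv F x) := by
    refine intervalIntegral.integral_eq_sub_of_hasDerivAt (f := fun z => Real.log (deriv F z))
      (fun z _ => ?_) (hF.continuous_deriv_div.intervalIntegrable _ _)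
    exact ((hF.contDiff_deriv.differentiable (by norm_num) z).hasDerivAt).log (hF.deriv_pos z).ne'
  rw [← h]
  exact intervalIntegral.abs_integral_le_integral_abs hxy

theorem exists_abs_log_deriv_le (hF : IsC2Lift F) : ∃ B, ∀ x, |Real.log (deriv F x)| ≤ B := by
  have hc : Continuous fun x => |Real.log (deriv F x)| :=
    (hF.continuous_deriv.log fun x => (hF.deriv_pos x).ne').abs
  have hp : Function.Periodic (fun x => |Real.log (deriv F x)|) 1 := fun x => by
    simp only [periodic_deriv F x]
  obtain ⟨B, hB⟩ := hp.compact_of_continuous one_ne_zero hc |>.bddAbove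
  exact ⟨B, fun x => hB ⟨x, rfl⟩⟩

theorem hasDerivAt_iterate (hF : IsC2Lift F) (m : ℕ) (x : ℝ) :
    HasDerivAt (F^[m]) (iterDeriv F m x) x := by
  induction m with
  | zero => simpa [iterDeriv] using hasDerivAt_id x
  | succ m ih =>
    rw [Function.iterate_succ', iterDeriv, Finset.prod_range_succ, mul_comm]
    exact (hF.hasDerivAt _).comp x ih

theorem iterDeriv_pos (hF : IsC2Lift F) (m : ℕ) (x : ℝ) : 0 < iterDeriv F m x :=
  Finset.prod_pos fun _ _ => hF.deriv_pos _

theorem log_iterDeriv (hF : IsC2Lift F) (m : ℕ) (x : ℝ) :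
    Real.log (iterDeriv F m x) = ∑ i ∈ Finset.range m, Real.log (deriv F (F^[i] x)) :=
  Real.log_prod fun _ _ => (hF.deriv_pos _).ne'

/-- Mean value theorem on [0, 1], where F^N increases by exactly 1. Orbits of such points play the
role of an invariant measure with zero Lyapunov exponent. -/
theorem exists_iterDeriv_eq_one (hF : IsC2Lift F) (N : ℕ) : ∃ x, iterDeriv F N x = 1 := by
  obtain ⟨x, -, hx⟩ := exists_hasDerivAt_eq_slope (F^[N]) (iterDeriv F N) zero_lt_one
    (HasDerivAt.continuousOn fun x _ => hF.hasDerivAt_iterate N x)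
    fun x _ => hF.hasDerivAt_iterate N x
  refine ⟨x, ?_⟩
  have := (F ^ N).map_add_one 0
  rw [CircleDeg1Lift.coe_pow, zero_add] at this
  rw [hx, this]
  ring

theorem exists_semiconj (hF : IsC2Lift F) :
    ∃ h : CircleDeg1Lift, ∀ x, h (F x) = h x + F.translationNumber := by
  obtain ⟨h, hh⟩ := CircleDeg1Lift.semiconj_of_bijective_of_translationNumber_eq hF.bijective
    (CircleDeg1Lift.isUnit_iff_bijective.1
      (CircleDeg1Lift.translate (Multiplicative.ofAdd F.translationNumber)).isUnit)
    (CircleDeg1Lift.translationNumber_translate _).symm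
  refine ⟨h, fun x => ?_⟩
  rw [hh x, CircleDeg1Lift.translate_apply, add_comm]

end IsC2Lift

/-! ### Disjoint arcs and shifted sums -/

/-- Arcs of the circle which are pairwise disjoint have total mass at most that of the circle. -/
theorem sum_integral_le_of_disjoint_arcs {w : ℝ → ℝ} (hw : Continuous w) (hw0 : ∀ x, 0 ≤ w x)
    (hper : Function.Periodic w 1) {ι : Type*} [DecidableEq ι] (s : Finset ι) (a b : ι → ℝ)
    (hab : ∀ i ∈ s, a i ≤ b i) (hb : ∀ i ∈ s, b i ≤ a i + 1)
    (hdis : ∀ i ∈ s, ∀ j ∈ s, i ≠ j → ∀ r : ℤ, b i ≤ a j + r ∨ b j + r ≤ a i) :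
    ∑ i ∈ s, ∫ x in a i..b i, w x ≤ ∫ x in (0 : ℝ)..1, w x := by
  rcases s.eq_empty_or_nonempty with rfl | ⟨j, hj⟩
  · simpa using intervalIntegral.integral_nonneg zero_le_one fun x _ => hw0 x
  -- Cut the circle at the start of one arc and translate every arc to start in [c, c + 1).
  -- Disjointness from the next copy of arc j keeps each of them from passing c + 1.
  set c := a j
  let r : ι → ℤ := fun i => -⌊a i - c⌋
  have hr : ∀ i, c ≤ a i + r i ∧ a i + r i < c + 1 := fun i => by
    have h1 := Int.floor_le (a i - c)
    have h2 := Int.lt_floor_add_one (a i - c)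
    simp only [r]
    push_cast
    constructor <;> linarith
  have hbr : ∀ i ∈ s, b i + r i ≤ c + 1 := by
    intro i hi
    by_cases hij : i = j
    · subst hij
      have : r i = 0 := by simp [r, c]
      rw [this]
      simpa using hb i hi
    · have := hdis i hi j hj hij (1 - r i)
      push_cast at this
      rcases this with h | h
      · linarith
      · linarith [(hr i).2, hab j hj]
  have hshift : ∀ i, ∫ x in a i..b i, w x = ∫ x in (a i + r i)..(b i + r i), w x := by
    intro i
    have hp : ∀ x, w (x + r i) = w x := fun x => by
      simpa using hper.int_mul (r i) x
    rw [← intervalIntegral.integral_comp_add_right]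
    simp only [hp]
  have h1 : ∀ i ∈ s, ∫ x in a i..b i, w x = ∫ x in Set.Ioc (a i + r i) (b i + r i), w x := by
    intro i hi
    rw [hshift, intervalIntegral.integral_of_le (by linarith [hab i hi])]
  have hint : IntegrableOn w (Set.Ioc c (c + 1)) := (hw.intervalIntegrable c (c + 1)).1
  have hsub : ∀ i ∈ s, Set.Ioc (a i + r i) (b i + r i) ⊆ Set.Ioc c (c + 1) := fun i hi =>
    Set.Ioc_subset_Ioc (hr i).1 (hbr i hi)
  rw [Finset.sum_congr rfl h1, ← integral_biUnion_finset s (fun _ _ => measurableSet_Ioc) ?_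
    fun i hi => hint.mono_set (hsub i hi)]
  · have h2 : ∫ x in (0 : ℝ)..1, w x = ∫ x in Set.Ioc c (c + 1), w x := by
      rw [← intervalIntegral.integral_of_le (by linarith), hper.intervalIntegral_add_eq c 0,
        zero_add]
    rw [h2]
    exact setIntegral_mono_set hint (Filter.Eventually.of_forall hw0)
      (Filter.Eventually.of_forall (Set.iUnion₂_subset hsub))
  · intro i hi k hk hik
    rw [Function.onFun, Set.disjoint_left]
    intro x hx hx'
    have := hdis i hi k hk hik (r k - r i)
    push_cast at this
    rcases this with h | h
    · linarith [hx.2, hx'.1]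
    · linarith [hx.1, hx'.2]

/-- Moving the summation window by one step replaces one term by the term N places later. Orbit sums
are thus shift invariant up to an error independent of N. -/
theorem sum_shift_sub_le {a : ℕ → ℝ} {C : ℝ} (N : ℕ) (h : ∀ n, a (n + N) - a n ≤ C) (s : ℕ) :
    ∑ n ∈ Finset.range N, a (n + s) - ∑ n ∈ Finset.range N, a n ≤ s * C := by
  induction s with
  | zero => simp
  | succ s ih =>
    have h1 := Finset.sum_range_succ (fun n => a (n + s)) N
    have h2 := Finset.sum_range_succ' (fun n => a (n + s)) N
    simp only [add_right_comm _ 1 s, zero_add] at h2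
    have := h s
    push_cast
    simp only [← add_assoc]
    rw [add_comm s N] at this
    linarith

theorem nonneg_of_forall_mul_add_nonneg {A B : ℝ} (h : ∀ N : ℕ, 0 ≤ A * N + B) : 0 ≤ A := by
  by_contra! hA
  obtain ⟨N, hN⟩ := exists_nat_gt (B / -A)
  rw [div_lt_iff₀ (by linarith)] at hN
  linarith [h N]

/-! ### Distortion along orbits and the bound on t -/

section

variable {F : CircleDeg1Lift} {t : ℝ} {p : ℤ} {q : ℕ}

theorem iterate_addConst_le (ht : 0 ≤ t) (n : ℕ) (x : ℝ) :
    (addConst F (-t))^[n] x ≤ F^[n] x :=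
  CircleDeg1Lift.iterate_mono (f := addConst F (-t)) (g := F)
    (fun y => by rw [addConst_apply]; linarith) n x

theorem semiconj_iterate {h : CircleDeg1Lift} {θ : ℝ} (hh : ∀ x, h (F x) = h x + θ)
    (n : ℕ) (x : ℝ) : h (F^[n] x) = h x + n * θ := by
  induction n with
  | zero => simp
  | succ n ih => rw [Function.iterate_succ_apply', hh, ih]; push_cast; ring

theorem semiconj_iterate_addConst_le {h : CircleDeg1Lift} {θ : ℝ} (hh : ∀ x, h (F x) = h x + θ)
    (ht : 0 ≤ t) (n : ℕ) (x : ℝ) : h ((addConst F (-t))^[n] x) ≤ h x + n * θ := by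
  rw [← semiconj_iterate hh]
  exact h.monotone (iterate_addConst_le ht n x)

/-- The q steps of F - t advance by at least p in total, and the last q - i of them by at most (q -
i)θ in the coordinate h. So the first i steps lag behind iθ by at most qθ - p. -/
theorem le_semiconj_iterate_addConst {h : CircleDeg1Lift} {θ : ℝ}
    (hh : ∀ x, h (F x) = h x + θ) (ht : 0 ≤ t)
    (hG : ∀ x, x + p ≤ (addConst F (-t))^[q] x) {i : ℕ} (hi : i ≤ q) (x : ℝ) :
    h x + i * θ - (q * θ - p) ≤ h ((addConst F (-t))^[i] x) := by
  have h1 := semiconj_iterate_addConst_le hh ht (q - i) ((addConst F (-t))^[i] x)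
  rw [← Function.iterate_add_apply, Nat.sub_add_cancel hi, Nat.cast_sub hi] at h1
  have h2 := h.monotone (hG x)
  rw [h.map_add_int] at h2
  linarith

/-- The arcs between the orbits of a point under `F` and `F - t` are disjoint in the circle up to
time `q`. -/
theorem orbit_arcs_disjoint (hF : IsC2Lift F) (hbest : IsBestApprox F.translationNumber p q)
    (hp : (p : ℝ) < q * F.translationNumber) (ht : 0 ≤ t)
    (hG : ∀ x, x + p ≤ (addConst F (-t))^[q] x) (x : ℝ) {i j : ℕ} (hi : i < q) (hj : j < q)
    (hij : i ≠ j) (r : ℤ) :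
    F^[i] x ≤ (addConst F (-t))^[j] x + r ∨ F^[j] x + r ≤ (addConst F (-t))^[i] x := by
  obtain ⟨h, hh⟩ := hF.exists_semiconj
  set θ := F.translationNumber
  have habs : |(q : ℝ) * θ - p| = q * θ - p := abs_of_pos (by linarith)
  -- In the coordinate h, each arc lies over an interval of length at most qθ - p, less than the
  -- distance between the images of F^i x and F^j x + r.
  have key : q * θ - p < |((i : ℝ) - j) * θ - r| := by
    rw [← habs]
    rcases lt_or_gt_of_ne hij with hlt | hlt
    · have := hbest.lt (j - i) (by omega) (by omega) (-r)
      rw [Nat.cast_sub hlt.le] at this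
      convert this using 1
      rw [← abs_neg]
      congr 1
      push_cast
      ring
    · have := hbest.lt (i - j) (by omega) (by omega) r
      rwa [Nat.cast_sub hlt.le] at this
  rcases lt_abs.1 key with hk | hk
  · right
    refine (h.monotone.reflect_lt ?_).le
    rw [h.map_add_int, semiconj_iterate hh]
    linarith [le_semiconj_iterate_addConst hh ht hG hi.le x]
  · left
    refine (h.monotone.reflect_lt ?_).le
    rw [h.map_add_int, semiconj_iterate hh]
    linarith [le_semiconj_iterate_addConst hh ht hG hj.le x]

theorem iterate_le_iterate_addConst_add_one (hF : IsC2Lift F)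
    (hbest : IsBestApprox F.translationNumber p q)
    (hp : (p : ℝ) < q * F.translationNumber) (ht : 0 ≤ t)
    (hG : ∀ x, x + p ≤ (addConst F (-t))^[q] x) (x : ℝ) {i : ℕ} (hi : i < q) :
    F^[i] x ≤ (addConst F (-t))^[i] x + 1 := by
  obtain ⟨h, hh⟩ := hF.exists_semiconj
  have h1 := hbest.lt_one
  rw [abs_of_pos (by linarith)] at h1
  refine (h.monotone.reflect_lt ?_).le
  rw [h.map_add_one, semiconj_iterate hh]
  linarith [le_semiconj_iterate_addConst hh ht hG hi.le x]

/-- Denjoy's distortion estimate, comparing iterates of `F` and of `F - t`. -/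
theorem exp_neg_distortion_mul_iterDeriv_le (hF : IsC2Lift F)
    (hbest : IsBestApprox F.translationNumber p q)
    (hp : (p : ℝ) < q * F.translationNumber) (ht : 0 ≤ t)
    (hG : ∀ x, x + p ≤ (addConst F (-t))^[q] x) (x : ℝ) {m : ℕ} (hm : m < q) {u : ℝ}
    (hu : addConst F (-t) x ≤ u) (hu' : u ≤ F x) :
    Real.exp (-distortion F) * iterDeriv F m (F x) ≤ iterDeriv (addConst F (-t)) m u := by
  set G := addConst F (-t) with hGdef
  have hGC : IsC2Lift G := hF.addConst _
  rw [← Real.exp_log (hF.iterDeriv_pos m (F x)), ← Real.exp_log (hGC.iterDeriv_pos m u),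
    ← Real.exp_add, Real.exp_le_exp, hF.log_iterDeriv, hGC.log_iterDeriv, hGdef, deriv_addConst,
    ← hGdef]
  -- The arc [G^i u, F^i(F x)] lies inside the arc of index i + 1 of the orbit of x. Since m < q,
  -- the indices i + 1 for i < m stay below q.
  have hlow : ∀ i, G^[i + 1] x ≤ G^[i] u := fun i => by
    rw [Function.iterate_succ_apply]
    exact (G.monotone.iterate i) hu
  have hmid : ∀ i, G^[i] u ≤ F^[i] (F x) := fun i =>
    ((G.monotone.iterate i) hu').trans (iterate_addConst_le ht i _)
  have hsum := sum_integral_le_of_disjoint_arcs hF.continuous_deriv_div.abs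
    (fun _ => abs_nonneg _)
    (fun y => by simp only [periodic_deriv F y, periodic_deriv_deriv F y])
    (Finset.range m) (fun i => G^[i] u) (fun i => F^[i] (F x)) (fun i _ => hmid i)
    (fun i hi => by
      have hi := Finset.mem_range.1 hi
      have := iterate_le_iterate_addConst_add_one hF hbest hp ht hG x (i := i + 1) (by omega)
      rw [Function.iterate_succ_apply] at this
      linarith [hlow i])
    (fun i hi j hj hij r => by
      have hi := Finset.mem_range.1 hi
      have hj := Finset.mem_range.1 hj
      have := orbit_arcs_disjoint hF hbest hp ht hG x (i := i + 1) (j := j + 1) (by omega)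
        (by omega) (by omega) r
      simp only [← hGdef, Function.iterate_succ_apply F] at this
      rcases this with h | h
      · exact Or.inl (h.trans (by linarith [hlow j]))
      · exact Or.inr (h.trans (hlow i)))
  have hle := Finset.sum_le_sum fun i (_ : i ∈ Finset.range m) =>
    (le_abs_self _).trans (hF.abs_log_deriv_sub_le (hmid i))
  rw [Finset.sum_sub_distrib] at hle
  have : distortion F = ∫ x in (0 : ℝ)..1, |deriv (deriv F) x / deriv F x| := rfl
  linarith

/-- Pass from G^q to F^q by replacing one G by F at a time. Each replacement opens a gap t, which
the remaining iterates of G expand by a derivative controlled through the distortion estimate. -/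
theorem le_iterate_sub_iterate_addConst (hF : IsC2Lift F) {n : ℕ}
    (hbest : IsBestApprox F.translationNumber p (n + 1))
    (hp : (p : ℝ) < (n + 1 : ℕ) * F.translationNumber) (ht : 0 ≤ t)
    (hG : ∀ x, x + p ≤ (addConst F (-t))^[n + 1] x) (x : ℝ) :
    t * (1 + Real.exp (-distortion F) *
      ∑ k ∈ Finset.range n, iterDeriv F (n - k) (F^[k + 1] x)) ≤
      F^[n + 1] x - (addConst F (-t))^[n + 1] x := by
  set G := addConst F (-t) with hGdef
  have hGC : IsC2Lift G := hF.addConst _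
  have htel := Finset.sum_range_sub (fun k => G^[n + 1 - k] (F^[k] x)) (n + 1)
  simp only [Nat.sub_self, Nat.sub_zero, Function.iterate_zero, id_eq] at htel
  rw [← htel, Finset.sum_range_succ, mul_add, mul_one, add_comm, Finset.mul_sum, Finset.mul_sum]
  refine add_le_add (Finset.sum_le_sum fun k hk => ?_) ?_
  · have hk := Finset.mem_range.1 hk
    rw [show n + 1 - (k + 1) = n - k by omega, show n + 1 - k = (n - k) + 1 by omega,
      Function.iterate_succ_apply G, Function.iterate_succ_apply' F k]
    set y := F^[k] x
    have hGy : G y = F y - t := by rw [hGdef, addConst_apply]; ring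
    rcases ht.eq_or_lt with h0 | h0
    · rw [hGy, ← h0]; simp
    obtain ⟨u, hu, hu'⟩ := exists_hasDerivAt_eq_slope (G^[n - k]) (iterDeriv G (n - k))
      (show G y < F y by linarith)
      (HasDerivAt.continuousOn fun z _ => hGC.hasDerivAt_iterate _ z)
      fun z _ => hGC.hasDerivAt_iterate _ z
    have hd := exp_neg_distortion_mul_iterDeriv_le hF hbest hp ht hG y (m := n - k)
      (by omega) hu.1.le hu.2.le
    rw [← hGdef, hu', hGy, sub_sub_cancel, le_div_iff₀ h0] at hd
    rw [hGy]
    linarith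
  -- The last replacement has no iterate after it, so its gap is exactly t, with no distortion loss.
  -- This is the 1 that later makes the inequality strict.
  · rw [Nat.sub_self, show n + 1 - n = 1 by omega, Function.iterate_succ_apply' F n]
    simp [hGdef]

theorem sum_iterate_add_sub_le (F : CircleDeg1Lift) (x : ℝ) (N s : ℕ) :
    ∑ n ∈ Finset.range N, F^[s] (F^[n] x) - ∑ n ∈ Finset.range N, F^[n] x ≤
      s * (N * F.translationNumber + 1) := by
  have := sum_shift_sub_le (a := fun n => F^[n] x) (C := N * F.translationNumber + 1) N
    (fun n => by
      have := (F ^ N).map_lt_add_translationNumber_add_one (F^[n] x)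
      rw [CircleDeg1Lift.translationNumber_pow, CircleDeg1Lift.coe_pow,
        ← Function.iterate_add_apply, add_comm N n] at this
      linarith) s
  simpa only [← Function.iterate_add_apply, add_comm s] using this

/-- By y ≥ 1 + log y, it suffices to bound sums of log F' from below. Over the initial window the
sum is 0 by the choice of x; each of the m windows is shifted by at most m + k, at a cost of 2B per
unit shift. -/
theorem le_sum_iterDeriv (hF : IsC2Lift F) {B : ℝ} (hB : ∀ x, |Real.log (deriv F x)| ≤ B)
    {N : ℕ} {x : ℝ} (hx : iterDeriv F N x = 1) (m k : ℕ) :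
    N - m * (m + k) * (2 * B) ≤ ∑ n ∈ Finset.range N, iterDeriv F m (F^[k] (F^[n] x)) := by
  have hB0 : 0 ≤ B := (abs_nonneg _).trans (hB 0)
  have h0 : ∑ n ∈ Finset.range N, Real.log (deriv F (F^[n] x)) = 0 := by
    rw [← hF.log_iterDeriv, hx, Real.log_one]
  have h1 : ∀ s : ℕ, -(s * (2 * B)) ≤
      ∑ n ∈ Finset.range N, Real.log (deriv F (F^[n + s] x)) := fun s => by
    have := sum_shift_sub_le (a := fun n => -Real.log (deriv F (F^[n] x))) (C := 2 * B) N
      (fun n => by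
        have := abs_le.1 (hB (F^[n] x))
        have := abs_le.1 (hB (F^[n + N] x))
        linarith) s
    simp only [Finset.sum_neg_distrib, h0] at this
    linarith
  have h2 : ∀ n, 1 + Real.log (iterDeriv F m (F^[k] (F^[n] x))) ≤
      iterDeriv F m (F^[k] (F^[n] x)) := fun n => by
    have := Real.log_le_sub_one_of_pos (hF.iterDeriv_pos m (F^[k] (F^[n] x)))
    linarith
  refine le_trans ?_ (Finset.sum_le_sum fun n _ => h2 n)
  rw [Finset.sum_add_distrib]
  simp only [hF.log_iterDeriv, ← Function.iterate_add_apply]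
  rw [Finset.sum_comm]
  have h3 : ∑ i ∈ Finset.range m, -((m + k : ℝ) * (2 * B)) ≤
      ∑ i ∈ Finset.range m, ∑ n ∈ Finset.range N, Real.log (deriv F (F^[i + (k + n)] x)) := by
    refine Finset.sum_le_sum fun i hi => ?_
    have := h1 (i + k)
    simp only [show ∀ n, i + (k + n) = n + (i + k) by intro n; ring]
    refine le_trans ?_ this
    have : (i : ℝ) ≤ m := by exact_mod_cast (Finset.mem_range.1 hi).le
    push_cast
    nlinarith
  simp only [Finset.sum_const, Finset.card_range, nsmul_eq_mul] at h3 ⊢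
  linarith

/-- If `F - t` still advances at least as fast as the rotation by the best approximation `p / q`
of the rotation number `θ` of `F`, then `t` is controlled by `θ - p / q`. -/
theorem mul_le_of_le_iterate_addConst (hF : IsC2Lift F)
    (hbest : IsBestApprox F.translationNumber p q)
    (hp : (p : ℝ) < q * F.translationNumber) (ht : 0 ≤ t)
    (hG : ∀ x, x + p ≤ (addConst F (-t))^[q] x) :
    t * (1 + Real.exp (-distortion F) * (q - 1)) ≤ q * F.translationNumber - p := by
  obtain ⟨n, rfl⟩ : ∃ n, q = n + 1 := ⟨q - 1, by have := hbest.pos; omega⟩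
  obtain ⟨B, hB⟩ := hF.exists_abs_log_deriv_le
  have hB0 : 0 ≤ B := (abs_nonneg _).trans (hB 0)
  set E := Real.exp (-distortion F) with hE
  have hE0 : 0 < E := Real.exp_pos _
  set θ := F.translationNumber
  -- A crude bound for all boundary terms; only its independence of N matters.
  set C : ℝ := n * ((n + 1) * (n + 1 + (n + 1)) * (2 * B))
  have key : ∀ N : ℕ, 0 ≤ (((n + 1 : ℕ) * θ - p) - t * (1 + E * ((n + 1 : ℕ) - 1))) * N +
      ((n + 1) + t * E * C) := by
    intro N
    obtain ⟨x, hx⟩ := hF.exists_iterDeriv_eq_one N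
    have h1 := Finset.sum_le_sum fun i (_ : i ∈ Finset.range N) =>
      (le_iterate_sub_iterate_addConst hF hbest hp ht hG (F^[i] x)).trans
        (sub_le_sub_left (hG (F^[i] x)) _)
    have h2 := sum_iterate_add_sub_le F x N (n + 1)
    rw [← Finset.mul_sum, Finset.sum_add_distrib, ← Finset.mul_sum, Finset.sum_comm,
      Finset.sum_sub_distrib, Finset.sum_add_distrib] at h1
    simp only [Finset.sum_const, Finset.card_range, nsmul_eq_mul] at h1
    have h3 : ∑ k ∈ Finset.range n, ((N : ℝ) - (n + 1) * (n + 1 + (n + 1)) * (2 * B)) ≤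
        ∑ k ∈ Finset.range n, ∑ i ∈ Finset.range N, iterDeriv F (n - k) (F^[k + 1] (F^[i] x)) := by
      refine Finset.sum_le_sum fun k hk => le_trans ?_ (le_sum_iterDeriv hF hB hx (n - k) (k + 1))
      have hk : (k : ℝ) ≤ n := by exact_mod_cast (Finset.mem_range.1 hk).le
      have hnk : ((n - k : ℕ) : ℝ) ≤ n + 1 := by
        have : n - k ≤ n + 1 := by omega
        exact_mod_cast this
      push_cast
      gcongr
    simp only [Finset.sum_const, Finset.card_range, nsmul_eq_mul] at h3
    have h4 := mul_le_mul_of_nonneg_left h3 (mul_nonneg ht hE0.le)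
    have e : (n : ℝ) * (N - (n + 1) * (n + 1 + (n + 1)) * (2 * B)) = n * N - C := by
      simp only [C]; ring
    rw [e] at h4
    push_cast at h2 ⊢
    nlinarith
  have := nonneg_of_forall_mul_add_nonneg key
  linarith

end

/-! ### Reaching the rational rotation number -/

theorem translationNumber_addConst_int (F : CircleDeg1Lift) (t : ℝ) (n : ℤ) :
    (addConst F (t + n)).translationNumber = (addConst F t).translationNumber + n := by
  have h1 : addConst F (t + n) =
      (CircleDeg1Lift.translate (Multiplicative.ofAdd (n : ℝ)) : CircleDeg1Lift) *
        addConst F t := by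
    ext x
    rw [CircleDeg1Lift.mul_apply, CircleDeg1Lift.translate_apply, addConst_apply, addConst_apply]
    ring
  have hcomm : Commute (CircleDeg1Lift.translate (Multiplicative.ofAdd (n : ℝ)) : CircleDeg1Lift)
      (addConst F t) := by
    rw [CircleDeg1Lift.commute_iff_commute]
    intro x
    rw [CircleDeg1Lift.translate_apply, CircleDeg1Lift.translate_apply,
      CircleDeg1Lift.map_int_add]
  rw [h1, CircleDeg1Lift.translationNumber_mul_of_commute hcomm,
    CircleDeg1Lift.translationNumber_translate, add_comm]

theorem addConst_zero (F : CircleDeg1Lift) : addConst F 0 = F := by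
  ext x
  simp

theorem translationNumber_addConst_mono (F : CircleDeg1Lift) :
    Monotone fun t => (addConst F t).translationNumber := fun _ _ hst =>
  CircleDeg1Lift.translationNumber_mono fun x => by
    simpa using hst

theorem continuous_iterate_addConst {F : CircleDeg1Lift} (hF : Continuous F) (n : ℕ) :
    Continuous fun z : ℝ × ℝ => (addConst F (-z.1))^[n] z.2 := by
  induction n with
  | zero => exact continuous_snd
  | succ n ih =>
    simp only [Function.iterate_succ_apply', addConst_apply]
    exact (hF.comp ih).add continuous_fst.neg

theorem exists_translationNumber_addConst_eq {F : CircleDeg1Lift} (hF : Continuous F) {p : ℤ}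
    {q : ℕ} (hq : 0 < q) (hp : (p : ℝ) < q * F.translationNumber) :
    ∃ t : ℝ, 0 ≤ t ∧ (∀ x, x + p ≤ (addConst F (-t))^[q] x) ∧
      (addConst F (-t)).translationNumber = p / q := by
  have hq' : (0 : ℝ) < q := by exact_mod_cast hq
  set T : Set ℝ := {t | ∀ x, x + p ≤ (addConst F (-t))^[q] x} with hT
  have hpow : ∀ t : ℝ, ((addConst F (-t)) ^ q).translationNumber =
      q * (addConst F (-t)).translationNumber := fun t =>
    CircleDeg1Lift.translationNumber_pow _ _
  have hle : ∀ t ∈ T, (p : ℝ) ≤ q * (addConst F (-t)).translationNumber := fun t ht => by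
    rw [← hpow]
    refine CircleDeg1Lift.le_translationNumber_of_add_le _ fun x => ?_
    rw [CircleDeg1Lift.coe_pow]
    exact ht x
  have hmem : ∀ t, (p : ℝ) < q * (addConst F (-t)).translationNumber →
      ∀ x, x + p < (addConst F (-t))^[q] x := fun t ht x => by
    rw [← CircleDeg1Lift.coe_pow]
    exact CircleDeg1Lift.lt_map_of_int_lt_translationNumber _ (by rwa [hpow]) x
  have h0 : (0 : ℝ) ∈ T := fun x => (hmem 0 (by rwa [neg_zero, addConst_zero]) x).le
  have hbdd : BddAbove T := by
    obtain ⟨n, hn⟩ := exists_nat_gt (F.translationNumber - p / q)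
    refine ⟨n, fun t ht => ?_⟩
    by_contra! hlt
    have h1 := hle t ht
    have h2 := translationNumber_addConst_mono F (show -t ≤ 0 + ((-n : ℤ) : ℝ) by
      push_cast; linarith)
    simp only [translationNumber_addConst_int, addConst_zero] at h2
    push_cast at h2
    have h3 : (p : ℝ) / q ≤ (addConst F (-t)).translationNumber := by
      rwa [div_le_iff₀ hq', mul_comm]
    linarith
  have hclosed : IsClosed T := by
    simp only [hT, Set.ofPred_forall]
    exact isClosed_iInter fun x => isClosed_le continuous_const
      ((continuous_iterate_addConst hF q).comp (continuous_id.prodMk continuous_const))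
  -- If the translation number at the maximal t exceeded p/q, then G^q x > x + p strictly. By
  -- compactness of a period, t could still be increased.
  have hsup : sSup T ∈ T := hclosed.csSup_mem ⟨0, h0⟩ hbdd
  refine ⟨sSup T, le_csSup hbdd h0, hsup, ?_⟩
  by_contra hne
  have hlt : (p : ℝ) < q * (addConst F (-sSup T)).translationNumber := by
    refine lt_of_le_of_ne (hle _ hsup) fun h => hne ?_
    rw [eq_div_iff hq'.ne', mul_comm, h]
  have hev : ∀ᶠ t in nhds (sSup T), ∀ x ∈ Set.Icc (0 : ℝ) 1,
      x + p < (addConst F (-t))^[q] x := by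
    refine isCompact_Icc.eventually_forall_of_forall_eventually fun x _ => ?_
    exact (isOpen_lt (continuous_snd.add continuous_const)
      (continuous_iterate_addConst hF q)).mem_nhds (hmem _ hlt x)
  obtain ⟨ε, hε, hball⟩ := Metric.eventually_nhds_iff.1 hev
  have hT' : sSup T + ε / 2 ∈ T := by
    intro x
    have h1 := CircleDeg1Lift.forall_map_sub_of_Icc (addConst F (-(sSup T + ε / 2)) ^ q)
      (fun y => (p : ℝ) < y) (fun y hy => by
        have := hball (y := sSup T + ε / 2) (by
          rw [Real.dist_eq, add_sub_cancel_left, abs_of_pos (by linarith)]; linarith) y hy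
        rw [CircleDeg1Lift.coe_pow]
        linarith) x
    rw [CircleDeg1Lift.coe_pow] at h1
    linarith
  linarith [le_csSup hbdd hT']

theorem le_exp_mul_of_mul_le {t D ξ : ℝ} {q : ℕ} (hq : 0 < q) (ht : 0 ≤ t) (hξ : 0 < ξ)
    (hD : 0 ≤ D) (h : t * (1 + Real.exp (-D) * (q - 1)) ≤ q * ξ) :
    t ≤ Real.exp D * ξ ∧ (0 < D → t < Real.exp D * ξ) := by
  have hq' : (1 : ℝ) ≤ q := by exact_mod_cast hq
  have hE : Real.exp D * Real.exp (-D) = 1 := by rw [← Real.exp_add, add_neg_cancel, Real.exp_zero]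
  have hE0 := Real.exp_pos D
  -- Multiplying by e^D leaves qt plus the surplus t(e^D - 1), which is positive when D and t are.
  have hmul : Real.exp D * (t * (1 + Real.exp (-D) * (q - 1))) =
      q * t + t * (Real.exp D - 1) := by
    linear_combination (t * (q - 1)) * hE
  have h1 := mul_le_mul_of_nonneg_left h hE0.le
  rw [hmul] at h1
  constructor
  · have : 1 ≤ Real.exp D := Real.one_le_exp hD
    have h2 : 0 ≤ t * (Real.exp D - 1) := mul_nonneg ht (by linarith)
    have h3 : q * t ≤ q * (Real.exp D * ξ) := by linarith
    exact le_of_mul_le_mul_left h3 (by linarith)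
  · intro hD'
    rcases ht.eq_or_lt with h0 | h0
    · rw [← h0]; positivity
    · have : 1 < Real.exp D := Real.one_lt_exp_iff.2 hD'
      have h2 : 0 < t * (Real.exp D - 1) := mul_pos h0 (by linarith)
      have h3 : q * t < q * (Real.exp D * ξ) := by linarith
      exact lt_of_mul_lt_mul_left h3 (by linarith)

theorem exists_addConst_of_lt {F : CircleDeg1Lift} (hF : IsC2Lift F) {p : ℤ} {q : ℕ}
    (hbest : IsBestApprox F.translationNumber p q) (hp : (p : ℝ) / q < F.translationNumber) :
    ∃ t : ℝ, 0 ≤ t ∧ (addConst F (-t)).translationNumber = p / q ∧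
      t ≤ Real.exp (distortion F) * (F.translationNumber - p / q) ∧
      (0 < distortion F → t < Real.exp (distortion F) * (F.translationNumber - p / q)) := by
  have hq' : (0 : ℝ) < q := by exact_mod_cast hbest.pos
  have hp' : (p : ℝ) < q * F.translationNumber := by rwa [div_lt_iff₀ hq', mul_comm] at hp
  obtain ⟨t, ht, hG, hrot⟩ := exists_translationNumber_addConst_eq hF.continuous hbest.pos hp'
  refine ⟨t, ht, hrot, le_exp_mul_of_mul_le hbest.pos ht (by linarith) (distortion_nonneg F) ?_⟩
  rw [mul_sub (q : ℝ) F.translationNumber, mul_div_cancel₀ _ hq'.ne']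
  exact mul_le_of_le_iterate_addConst hF hbest hp' ht hG

/-! ### Approximations from above, and the case of zero distortion -/

/-- The conjugate of `F` by `x ↦ -x`. -/
def reflect (F : CircleDeg1Lift) : CircleDeg1Lift where
  toFun x := -F (-x)
  monotone' _ _ h := neg_le_neg (F.monotone (neg_le_neg h))
  map_add_one' x := by
    have := F.map_add_one (-(x + 1))
    rw [show -(x + 1) + 1 = -x by ring] at this
    rw [this]
    ring

theorem reflect_apply (F : CircleDeg1Lift) (x : ℝ) : reflect F x = -F (-x) := rfl

theorem reflect_addConst (F : CircleDeg1Lift) (t : ℝ) :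
    addConst (reflect F) (-t) = reflect (addConst F t) := by
  ext x
  simp only [addConst_apply, reflect_apply]
  ring

theorem translationNumber_reflect (F : CircleDeg1Lift) :
    (reflect F).translationNumber = -F.translationNumber := by
  refine CircleDeg1Lift.translationNumber_eq_of_tendsto₀ _ ?_
  have h : ∀ n : ℕ, (reflect F)^[n] 0 = -(F ^ n) 0 := fun n => by
    induction n with
    | zero => simp
    | succ n ih =>
      rw [Function.iterate_succ_apply', ih, reflect_apply, neg_neg, pow_succ',
        CircleDeg1Lift.mul_apply]
  simp only [h, neg_div]
  exact F.tendsto_translation_number₀.neg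

theorem deriv_reflect (F : CircleDeg1Lift) (x : ℝ) : deriv (reflect F) x = deriv F (-x) := by
  rw [show (reflect F : ℝ → ℝ) = fun x => -F (-x) from rfl, deriv.fun_neg, deriv_comp_neg,
    neg_neg]

theorem IsC2Lift.reflect {F : CircleDeg1Lift} (hF : IsC2Lift F) : IsC2Lift (reflect F) :=
  ⟨(hF.contDiff.comp contDiff_neg).neg, fun x => by rw [deriv_reflect]; exact hF.deriv_pos _⟩

theorem distortion_reflect (F : CircleDeg1Lift) : distortion (reflect F) = distortion F := by
  have h : ∀ x, |deriv (deriv (reflect F)) x / deriv (reflect F) x| =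
      |deriv (deriv F) (-x) / deriv F (-x)| := fun x => by
    rw [show deriv (reflect F) = fun x => deriv F (-x) from funext (deriv_reflect F),
      deriv_comp_neg, neg_div, abs_neg]
  have hper : Function.Periodic (fun x => |deriv (deriv F) x / deriv F x|) 1 := fun x => by
    simp only [periodic_deriv F x, periodic_deriv_deriv F x]
  rw [distortion, distortion]
  simp only [h]
  rw [intervalIntegral.integral_comp_neg (fun x => |deriv (deriv F) x / deriv F x|), neg_zero]
  have := hper.intervalIntegral_add_eq (-1) 0
  rwa [neg_add_cancel, zero_add] at this

/-- A best approximation `p / q` of the rotation number `θ` of `F` is attained as rotation number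
at a translation parameter of size at most `exp D * |θ - p / q|`. -/
theorem exists_addConst {F : CircleDeg1Lift} (hF : IsC2Lift F)
    (hirr : Irrational F.translationNumber) {p : ℤ} {q : ℕ}
    (hbest : IsBestApprox F.translationNumber p q) :
    ∃ t : ℝ, (addConst F t).translationNumber = p / q ∧
      |t| ≤ Real.exp (distortion F) * |F.translationNumber - p / q| ∧
      (0 < distortion F → |t| < Real.exp (distortion F) * |F.translationNumber - p / q|) := by
  have hne : (p : ℝ) / q ≠ F.translationNumber := fun h => hirr ⟨(p : ℚ) / q, by
    rw [← h]; push_cast; rfl⟩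
  rcases lt_or_gt_of_ne hne with h | h
  · obtain ⟨t, ht, hrot, hle, hlt⟩ := exists_addConst_of_lt hF hbest h
    refine ⟨-t, hrot, ?_⟩
    rw [abs_neg, abs_of_nonneg ht, abs_of_pos (sub_pos.2 h)]
    exact ⟨hle, hlt⟩
  · obtain ⟨t, ht, hrot, hle, hlt⟩ := exists_addConst_of_lt hF.reflect (p := -p) (q := q)
      (by rw [translationNumber_reflect]; exact hbest.neg)
      (by rw [translationNumber_reflect]; push_cast; rw [neg_div]; linarith)
    rw [reflect_addConst, translationNumber_reflect] at hrot
    rw [distortion_reflect, translationNumber_reflect] at hle hlt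
    push_cast at hrot hle hlt
    have e : -F.translationNumber - -(p : ℝ) / q = p / q - F.translationNumber := by ring
    rw [e] at hle hlt
    refine ⟨t, by rw [neg_div] at hrot; linarith, ?_⟩
    rw [abs_of_nonneg ht, abs_sub_comm, abs_of_pos (sub_pos.2 h)]
    exact ⟨hle, hlt⟩

theorem IsC2Lift.eq_add_of_distortion_le_zero {F : CircleDeg1Lift} (hF : IsC2Lift F)
    (h : distortion F ≤ 0) (x : ℝ) : F x = x + F 0 := by
  have hper : Function.Periodic (fun x => |deriv (deriv F) x / deriv F x|) 1 := fun x => by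
    simp only [periodic_deriv F x, periodic_deriv_deriv F x]
  have h0 : ∀ x, deriv (deriv F) x = 0 := by
    intro x
    by_contra hx
    obtain ⟨y, hy, hxy⟩ := hper.exists_mem_Ico₀ one_pos x
    have hpos : 0 < |deriv (deriv F) y / deriv F y| := by
      rw [← hxy]
      exact abs_pos.2 (div_ne_zero hx (hF.deriv_pos x).ne')
    exact h.not_gt (intervalIntegral.integral_pos one_pos hF.continuous_deriv_div.abs.continuousOn
      (fun _ _ => abs_nonneg _) ⟨y, ⟨hy.1, hy.2.le⟩, hpos⟩)
  obtain ⟨z, hz⟩ := hF.exists_iterDeriv_eq_one 1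
  have h1 : ∀ x, deriv F x = 1 := fun x => by
    rw [is_const_of_deriv_eq_zero (hF.contDiff_deriv.differentiable (by norm_num)) h0 x z]
    simpa [iterDeriv] using hz
  have h2 : ∀ x, HasDerivAt (fun y => F y - y) 0 x := fun x => by
    have := (hF.hasDerivAt x).sub (hasDerivAt_id x)
    rwa [h1, sub_self] at this
  have := is_const_of_deriv_eq_zero (fun x => (h2 x).differentiableAt) (fun x => (h2 x).deriv) x 0
  linarith

/-! ### From lifts back to circle maps -/

theorem IsC2Diffeo.exists_isC2Lift {f : UnitAddCircle ≃ UnitAddCircle} (hf : IsC2Diffeo f) :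
    ∃ F : CircleDeg1Lift, IsLift F f ∧ IsC2Lift F := by
  obtain ⟨F, hF⟩ := hf.exists_isLift
  obtain ⟨F₀, hF₀, hC⟩ := hf.isC2Map
  obtain ⟨H, hH, hHC⟩ := hf.isC2Map_symm
  obtain ⟨m, hm⟩ := hF.exists_int hF₀
  have hFC : ContDiff ℝ 2 F := by
    rw [show (F : ℝ → ℝ) = fun x => F₀ x + m from funext hm]
    exact hC.add contDiff_const
  refine ⟨F, hF, hFC, fun x => ?_⟩
  have h1 : IsLift (fun x => H (F x)) id := ⟨hH.continuous.comp hF.continuous, fun x => by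
    rw [hH.coe_apply, hF.coe_apply, Equiv.symm_apply_apply, id]⟩
  have h2 : IsLift (fun x => x) id := ⟨continuous_id, fun _ => rfl⟩
  obtain ⟨k, hk⟩ := h1.exists_int h2
  have hF' := (hFC.differentiable (by norm_num) x).hasDerivAt
  have hH' := (hHC.differentiable (by norm_num) (F x)).hasDerivAt
  have h3 := hH'.comp x hF'
  rw [show H ∘ F = fun x => x + (k : ℝ) from funext hk] at h3
  have h4 := h3.unique ((hasDerivAt_id x).add_const (k : ℝ))
  have h5 : 0 ≤ deriv F x := F.monotone.deriv_nonneg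
  refine lt_of_le_of_ne h5 fun h => ?_
  rw [← h, mul_zero] at h4
  exact zero_ne_one h4

theorem IsLift.addConst {F : CircleDeg1Lift} {f : UnitAddCircle → UnitAddCircle}
    (hF : IsLift F f) (t : ℝ) : IsLift (addConst F t) (shift f t) :=
  ⟨hF.continuous.add continuous_const, fun x => by
    rw [addConst_apply, AddCircle.coe_add, hF.coe_apply, shift]⟩

theorem norm_coe_le_abs (t : ℝ) : ‖(t : UnitAddCircle)‖ ≤ |t| := by
  rw [UnitAddCircle.norm_eq]
  simpa using round_le t 0

theorem coe_int_eq_zero (n : ℤ) : ((n : ℝ) : UnitAddCircle) = 0 :=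
  (AddCircle.coe_eq_zero_iff (1 : ℝ)).2 ⟨n, by simp⟩

theorem IsC2Lift.distortion_pos {F : CircleDeg1Lift} {f : UnitAddCircle → UnitAddCircle}
    (hF : IsC2Lift F) (hFf : IsLift F f) (hf : ¬ IsRotation f) : 0 < distortion F := by
  by_contra! h
  refine hf ⟨(F 0 : ℝ), fun x => ?_⟩
  obtain ⟨x, rfl⟩ := QuotientAddGroup.mk_surjective x
  have := hFf.coe_apply x
  rw [hF.eq_add_of_distortion_le_zero h x, AddCircle.coe_add] at this
  exact this.symm

theorem exists_isC2Lift_translationNumber_eq {f : UnitAddCircle ≃ UnitAddCircle}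
    (hf : IsC2Diffeo f) {θ : ℝ} (hθ : rot f = (θ : UnitAddCircle)) :
    ∃ F : CircleDeg1Lift, IsLift F f ∧ IsC2Lift F ∧ F.translationNumber = θ := by
  obtain ⟨F, hFf, hF⟩ := hf.exists_isC2Lift
  rw [rot_eq hFf, ← sub_eq_zero, ← AddCircle.coe_sub] at hθ
  obtain ⟨k, hk⟩ := (AddCircle.coe_eq_zero_iff (1 : ℝ)).1 hθ
  refine ⟨addConst F (0 + ((-k : ℤ) : ℝ)), ⟨hFf.continuous.add continuous_const, fun x => ?_⟩,
    hF.addConst _, ?_⟩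
  · rw [addConst_apply, zero_add, AddCircle.coe_add, coe_int_eq_zero, add_zero, hFf.coe_apply]
  · rw [translationNumber_addConst_int, addConst_zero]
    simp only [zsmul_eq_mul, mul_one] at hk
    push_cast
    linarith

theorem exists_shift_rot_eq_convergent {f : UnitAddCircle ≃ UnitAddCircle} (hf : IsC2Diffeo f)
    {θ : ℝ} (hθ : Irrational θ) (hrot : rot f = (θ : UnitAddCircle)) (n : ℕ) :
    ∃ ω : UnitAddCircle, rot (shift f ω) = ((θ.convergent n : ℝ) : UnitAddCircle) ∧
      ‖ω‖ ≤ Real.exp (distortionConst f) * ‖((θ - (θ.convergent n : ℝ) : ℝ) : UnitAddCircle)‖ ∧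
      (¬ IsRotation f → ‖ω‖ < Real.exp (distortionConst f) *
        ‖((θ - (θ.convergent n : ℝ) : ℝ) : UnitAddCircle)‖) := by
  obtain ⟨F, hFf, hF, rfl⟩ := exists_isC2Lift_translationNumber_eq hf hrot
  set θ := F.translationNumber
  obtain ⟨hbest, hlt⟩ := isBestApprox_convergent hθ n
  set r := θ.convergent n
  have hr : (r : ℝ) = r.num / r.den := Rat.cast_def r
  obtain ⟨p, hp, hcoe, hnorm⟩ : ∃ p : ℤ, IsBestApprox θ p r.den ∧
      (((p : ℝ) / r.den : ℝ) : UnitAddCircle) = ((r : ℝ) : UnitAddCircle) ∧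
      ‖((θ - (r : ℝ) : ℝ) : UnitAddCircle)‖ = |θ - p / r.den| := by
    -- For denominator 1 the circle norm measures the distance to the nearest integer, which need
    -- not be the convergent itself; `round θ` replaces it and has the same class. For denominator
    -- at least 2, |θ - r| is less than 1/2 and equals the circle norm.
    rcases (Nat.succ_le_of_lt r.den_pos).eq_or_lt with h1 | h1
    · have h1 : r.den = 1 := h1.symm
      rw [h1, Nat.cast_one, div_one] at hr
      rw [h1, hr]
      refine ⟨round θ, ⟨one_pos, ?_, fun m hm hm' => by omega⟩, ?_, ?_⟩
      · rw [Nat.cast_one, one_mul]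
        exact (abs_sub_round θ).trans_lt (by norm_num)
      · rw [Nat.cast_one, div_one, coe_int_eq_zero, coe_int_eq_zero]
      · rw [Nat.cast_one, div_one, UnitAddCircle.norm_eq, round_sub_intCast]
        push_cast
        congr 1
        ring
    · refine ⟨r.num, hbest, by rw [hr], ?_⟩
      rw [hr, AddCircle.norm_coe_eq_abs_iff _ one_ne_zero]
      have h2 : (2 : ℝ) ≤ r.den := by exact_mod_cast h1
      have h3 : (r.den : ℝ) * |θ - r.num / r.den| < 1 / r.den := by
        rw [← abs_of_pos (show (0 : ℝ) < r.den by linarith), ← abs_mul,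
          abs_of_pos (show (0 : ℝ) < r.den by linarith), mul_sub, mul_div_cancel₀ _ (by linarith)]
        exact hlt
      have h4 : 1 / (r.den : ℝ) ≤ 1 / 2 := one_div_le_one_div_of_le two_pos h2
      rw [abs_one]
      nlinarith [abs_nonneg (θ - r.num / r.den)]
  obtain ⟨t, ht, hle, hlt'⟩ := exists_addConst hF hθ hp
  have hD : distortionConst f = distortion F := distortionConst_eq hFf
  refine ⟨t, ?_, ?_, fun hnr => ?_⟩
  · rw [rot_eq (hFf.addConst t), ht, hcoe]
  · rw [hD, hnorm]
    exact (norm_coe_le_abs t).trans hle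
  · rw [hD, hnorm]
    exact (norm_coe_le_abs t).trans_lt (hlt' (hF.distortion_pos hFf hnr))

/-! ### Tsujii's theorem -/

/-- The translation parameters with rotation number `ρ`. -/
def rotLevelSet (F : CircleDeg1Lift) (ρ : ℝ) : Set ℝ :=
  {t | (addConst F t).translationNumber = ρ}

/-- A parameter with irrational rotation number close to `k / q` is close to one of the endpoints
of the parameter interval with rotation number `k / q`. -/
theorem abs_sub_endpoint_le {F : CircleDeg1Lift} (hF : IsC2Lift F) {t : ℝ}
    (hirr : Irrational (addConst F t).translationNumber) {k : ℤ} {q : ℕ}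
    (hbest : IsBestApprox (addConst F t).translationNumber k q) :
    |t - sSup (rotLevelSet F (k / q))| ≤
        Real.exp (distortion F) * |(addConst F t).translationNumber - k / q| ∨
      |t - sInf (rotLevelSet F (k / q))| ≤
        Real.exp (distortion F) * |(addConst F t).translationNumber - k / q| := by
  obtain ⟨s, hs, hle, -⟩ := exists_addConst (hF.addConst t) hirr hbest
  rw [distortion_addConst] at hle
  have hadd : addConst (addConst F t) s = addConst F (t + s) := by
    ext x
    simp only [addConst_apply]
    ring
  rw [hadd] at hs
  have hne : (addConst F t).translationNumber ≠ k / q := fun h => hirr ⟨(k : ℚ) / q, by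
    rw [h]; push_cast; rfl⟩
  have hmono := translationNumber_addConst_mono F
  have hmem : t + s ∈ rotLevelSet F (k / q) := hs
  -- By monotonicity the whole level set lies on one side of t. Its endpoint nearest to t therefore
  -- lies between t and the point t + s of the level set.
  rcases lt_or_gt_of_ne hne with h | h
  · right
    have hb : ∀ x ∈ rotLevelSet F (k / q), t ≤ x := fun x hx => by
      by_contra! hlt
      have := hmono hlt.le
      simp only [show (addConst F x).translationNumber = k / q from hx] at this
      linarith
    have h1 : t ≤ sInf (rotLevelSet F (k / q)) := le_csInf ⟨_, hmem⟩ hb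
    have h2 : sInf (rotLevelSet F (k / q)) ≤ t + s := csInf_le ⟨t, hb⟩ hmem
    refine le_trans ?_ hle
    rw [abs_of_nonpos (by linarith)]
    linarith [le_abs_self s]
  · left
    have hb : ∀ x ∈ rotLevelSet F (k / q), x ≤ t := fun x hx => by
      by_contra! hlt
      have := hmono hlt.le
      simp only [show (addConst F x).translationNumber = k / q from hx] at this
      linarith
    have h1 : sSup (rotLevelSet F (k / q)) ≤ t := csSup_le ⟨_, hmem⟩ hb
    have h2 : t + s ≤ sSup (rotLevelSet F (k / q)) := le_csSup ⟨t, hb⟩ hmem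
    refine le_trans ?_ hle
    rw [abs_of_nonneg (by linarith)]
    linarith [neg_abs_le s]

theorem liouville_subset {F : CircleDeg1Lift} {f : UnitAddCircle → UnitAddCircle}
    (hF : IsC2Lift F) (hFf : IsLift F f) {c : ℝ} (hc : 0 < c) (hc' : c < 1 / 2) :
    {ω : UnitAddCircle | IsLiouville (rot (shift f ω))} ⊆
      ⋃ n : ℕ, ⋃ k ∈ Finset.range (n + 1),
        (Metric.closedBall ((sSup (rotLevelSet F (((k : ℤ) : ℝ) / (n + 1 : ℕ))) : ℝ) : UnitAddCircle)
            (Real.exp (distortion F) * (c / ((n + 1 : ℕ) : ℝ) ^ 3)) ∪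
          Metric.closedBall ((sInf (rotLevelSet F (((k : ℤ) : ℝ) / (n + 1 : ℕ))) : ℝ) : UnitAddCircle)
            (Real.exp (distortion F) * (c / ((n + 1 : ℕ) : ℝ) ^ 3))) := by
  rintro ω ⟨hirr, hdio⟩
  obtain ⟨t, rfl⟩ := QuotientAddGroup.mk_surjective ω
  have hrot : rot (shift f (t : UnitAddCircle)) =
      ((addConst F t).translationNumber : UnitAddCircle) := rot_eq (hFf.addConst t)
  change ¬ IsDiophantine (rot (shift f (t : UnitAddCircle))) at hdio
  change IsIrrational (rot (shift f (t : UnitAddCircle))) at hirr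
  rw [hrot] at hirr hdio
  set τ := (addConst F t).translationNumber
  have hτ : Irrational τ := by
    rintro ⟨r, hr⟩
    exact hirr r (by rw [hr])
  simp only [IsDiophantine, not_exists, not_and, not_forall, not_lt] at hdio
  -- The exponent β = 1 suffices: there are q numerators for each q, and q · q⁻³ is summable. The
  -- assumption c < 1/2 makes r a best approximation.
  obtain ⟨r, hr⟩ := hdio c hc 1 one_pos
  rw [show (2 + 1 : ℝ) = (3 : ℕ) by norm_num, Real.rpow_natCast, ← AddCircle.coe_sub,
    UnitAddCircle.norm_eq] at hr
  set q := r.den with hq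
  have hq0 : 0 < q := r.den_pos
  have hqR : (1 : ℝ) ≤ q := by exact_mod_cast hq0
  -- Reduce the numerator modulo q, and below move t by an integer accordingly, so that only 0 ≤ k <
  -- q occur.
  set j := r.num / (q : ℤ)
  have hk0 : 0 ≤ r.num % (q : ℤ) := Int.emod_nonneg _ (by omega)
  have hkq : r.num % (q : ℤ) < q := Int.emod_lt_of_pos _ (by omega)
  obtain ⟨k, hk⟩ := Int.eq_ofNat_of_zero_le hk0
  have hnum : r.num = k + q * j := by rw [← hk]; exact (Int.emod_add_mul_ediv _ _).symm
  have hrR : (r : ℝ) = ((k : ℤ) : ℝ) / q + j := by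
    rw [Rat.cast_def, hnum]
    push_cast
    rw [← hq]
    field_simp
  set n := round (τ - (r : ℝ))
  have hτ' : (addConst F (t + ((-(n + j) : ℤ) : ℝ))).translationNumber = τ - n - j := by
    rw [translationNumber_addConst_int]
    push_cast
    ring
  have hdist : |τ - n - j - ((k : ℤ) : ℝ) / q| ≤ c / (q : ℝ) ^ 3 := by
    refine le_trans (le_of_eq ?_) hr
    rw [hrR]
    congr 1
    ring
  have hcop : IsCoprime (k : ℤ) (q : ℤ) := by
    have h1 : IsCoprime r.num (q : ℤ) := Int.isCoprime_iff_gcd_eq_one.2 r.reduced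
    rw [hnum] at h1
    exact IsCoprime.add_mul_left_left_iff.1 h1
  have hbest : IsBestApprox (τ - n - j) (k : ℤ) q := by
    refine isBestApprox_of_abs_lt hq0 hcop ?_
    have h1 : (q : ℝ) * (τ - n - j) - ((k : ℤ) : ℝ) = q * (τ - n - j - ((k : ℤ) : ℝ) / q) := by
      field_simp
    rw [h1, abs_mul, abs_of_pos (by linarith : (0 : ℝ) < q)]
    calc (q : ℝ) * |τ - n - j - ((k : ℤ) : ℝ) / q| ≤ q * (c / (q : ℝ) ^ 3) := by gcongr
      _ = c / (q : ℝ) ^ 2 := by field_simp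
      _ ≤ c / q := by
        gcongr
        nlinarith
      _ < (1 / 2) / q := by gcongr
      _ = 1 / (2 * q) := by field_simp
  have hτ'' : Irrational (τ - n - j) := (hτ.sub_intCast n).sub_intCast j
  rw [← hτ'] at hτ'' hbest hdist
  have hcoe : ((t + ((-(n + j) : ℤ) : ℝ) : ℝ) : UnitAddCircle) = t := by
    rw [AddCircle.coe_add, coe_int_eq_zero, add_zero]
  have hqs : q - 1 + 1 = q := by omega
  refine Set.mem_iUnion.2 ⟨q - 1, Set.mem_iUnion₂.2 ⟨k, Finset.mem_range.2 (by omega), ?_⟩⟩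
  rw [hqs]
  have hfin : ∀ x : ℝ, |t + ((-(n + j) : ℤ) : ℝ) - x| ≤ Real.exp (distortion F) *
      |(addConst F (t + ((-(n + j) : ℤ) : ℝ))).translationNumber - ((k : ℤ) : ℝ) / q| →
      ((t : ℝ) : UnitAddCircle) ∈ Metric.closedBall ((x : ℝ) : UnitAddCircle)
        (Real.exp (distortion F) * (c / (q : ℝ) ^ 3)) := fun x hx => by
    rw [Metric.mem_closedBall, dist_eq_norm, ← hcoe, ← AddCircle.coe_sub]
    exact (norm_coe_le_abs _).trans (hx.trans (by gcongr))
  rcases abs_sub_endpoint_le hF hτ'' hbest with h | h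
  · exact Or.inl (hfin _ h)
  · exact Or.inr (hfin _ h)

theorem volume_liouville_le {F : CircleDeg1Lift} {f : UnitAddCircle → UnitAddCircle}
    (hF : IsC2Lift F) (hFf : IsLift F f) : ∃ K : ℝ, ∀ c : ℝ, 0 < c → c < 1 / 2 →
    volume {ω : UnitAddCircle | IsLiouville (rot (shift f ω))} ≤ ENNReal.ofReal (c * K) := by
  set E := Real.exp (distortion F)
  have hE : 0 < E := Real.exp_pos _
  have hsum : Summable fun n : ℕ => 1 / (((n + 1 : ℕ) : ℝ)) ^ 2 :=
    (summable_nat_add_iff 1).2 (Real.summable_one_div_nat_pow.2 one_lt_two)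
  -- The factor 4 comes from two endpoints and balls of measure at most twice their radius; the q
  -- numerators turn q⁻³ into q⁻².
  refine ⟨4 * E * ∑' n : ℕ, 1 / (((n + 1 : ℕ) : ℝ)) ^ 2, fun c hc hc' => ?_⟩
  have hball : ∀ (x : UnitAddCircle) (ε : ℝ),
      volume (Metric.closedBall x ε) ≤ ENNReal.ofReal (2 * ε) := fun x ε => by
    rw [AddCircle.volume_closedBall]
    exact ENNReal.ofReal_le_ofReal (min_le_right _ _)
  calc volume {ω : UnitAddCircle | IsLiouville (rot (shift f ω))}
      ≤ _ := measure_mono (liouville_subset hF hFf hc hc')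
    _ ≤ ∑' n : ℕ, ∑ k ∈ Finset.range (n + 1),
        (ENNReal.ofReal (2 * (E * (c / ((n + 1 : ℕ) : ℝ) ^ 3))) +
          ENNReal.ofReal (2 * (E * (c / ((n + 1 : ℕ) : ℝ) ^ 3)))) := by
      refine (measure_iUnion_le _).trans (ENNReal.tsum_le_tsum fun n => ?_)
      refine (measure_biUnion_finset_le _ _).trans (Finset.sum_le_sum fun k _ => ?_)
      exact (measure_union_le _ _).trans (add_le_add (hball _ _) (hball _ _))
    _ = ∑' n : ℕ, ENNReal.ofReal (c * (4 * E) * (1 / (((n + 1 : ℕ) : ℝ)) ^ 2)) := by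
      congr 1
      funext n
      have h0 : (0 : ℝ) < (n + 1 : ℕ) := by positivity
      rw [Finset.sum_const, Finset.card_range, nsmul_eq_mul,
        ← ENNReal.ofReal_add (by positivity) (by positivity), ← ENNReal.ofReal_natCast,
        ← ENNReal.ofReal_mul h0.le]
      congr 1
      field_simp
      ring
    _ = ENNReal.ofReal (c * (4 * E * ∑' n : ℕ, 1 / (((n + 1 : ℕ) : ℝ)) ^ 2)) := by
      rw [← ENNReal.ofReal_tsum_of_nonneg (fun n => by positivity) (hsum.mul_left _),
        tsum_mul_left]
      congr 1
      ring

theorem volume_liouville_eq_zero {f : UnitAddCircle ≃ UnitAddCircle} (hf : IsC2Diffeo f) :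
    volume {ω : UnitAddCircle | IsLiouville (rot (shift f ω))} = 0 := by
  obtain ⟨F, hFf, hF⟩ := hf.exists_isC2Lift
  obtain ⟨K, hK⟩ := volume_liouville_le hF hFf
  have hlim : Filter.Tendsto (fun c : ℝ => ENNReal.ofReal (c * K)) (nhdsWithin 0 (Set.Ioi 0))
      (nhds 0) := by
    have : Continuous fun c : ℝ => ENNReal.ofReal (c * K) :=
      ENNReal.continuous_ofReal.comp (continuous_mul_const K)
    simpa using this.continuousWithinAt (s := Set.Ioi 0) (x := 0) |>.tendsto
  refine le_antisymm (ge_of_tendsto hlim ?_) zero_le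
  filter_upwards [Ioo_mem_nhdsGT (show (0 : ℝ) < 1 / 2 by norm_num)] with c hc
  exact hK c hc.1 hc.2

end CircleDynamics

theorem mainTheorem9 (f : UnitAddCircle ≃ UnitAddCircle) (hf : CircleDynamics.IsC2Diffeo f) :
    (∀ θ : ℝ, Irrational θ → CircleDynamics.rot f = (θ : UnitAddCircle) → ∀ n : ℕ,
      ∃ ω : UnitAddCircle,
        CircleDynamics.rot (CircleDynamics.shift f ω)
            = ((θ.convergent n : ℝ) : UnitAddCircle) ∧
        ‖ω‖ ≤ Real.exp (CircleDynamics.distortionConst f)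
            * ‖((θ - (θ.convergent n : ℝ) : ℝ) : UnitAddCircle)‖ ∧
        (¬ CircleDynamics.IsRotation f →
          ‖ω‖ < Real.exp (CircleDynamics.distortionConst f)
            * ‖((θ - (θ.convergent n : ℝ) : ℝ) : UnitAddCircle)‖)) ∧
    volume {ω : UnitAddCircle |
      CircleDynamics.IsLiouville (CircleDynamics.rot (CircleDynamics.shift f ω))} = 0 := by
  exact ⟨fun _ hθ hrot n => CircleDynamics.exists_shift_rot_eq_convergent hf hθ hrot n,
    CircleDynamics.volume_liouville_eq_zero hf⟩
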